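/- Let $G$ be an infinite, locally finite, connected graph with vertex set $V$, without loops or multiple edges. Let $d$ be the graph distance, $m(x)$ the valence (degree) of a vertex $x$, and $\Delta f(x)=\sum_{y\sim x}\bigl(f(x)-f(y)\bigr)$ the Laplacian. For $o\in V$ and $r\in\{0,1,2,\dots\}$ let $B_r(o)=\{x: d(o,x)\le r\}$ and let $\operatorname{int}B_r(o)$ be the set of vertices of $B_r(o)$ all of whose neighbours lie in $B_r(o)$. Let $\Delta_r f=(\Delta f)|_{\operatorname{int}B_r(o)}$ be the reduced Laplacian, acting on the functions that vanish outside $\operatorname{int}B_r(o)$, and let $p^r_t(x,y)=(e^{-t\Delta_r}\delta_x)(y)$ for $x,y\in\operatorname{int}B_r(o)$ and $p^r_t(x,y)=0$ for all other pairs of vertices. The heat kernel of $G$ is $$p_t(x,y)=\lim_{r\to\infty}p^r_t(x,y),\qquad x,y\in V,\ t\ge 0.$$ **Theorem.** Suppose that there is a vertex $x_0$ of $G$ such that, with $M(r)=\max\{m(x): d(x_0,x)=r\}$, $$\sum_{r=0}^{\infty}\frac1{M(r)}=\infty .$$ Then $G$ is stochastically complete. That is, for every centre $o\in V$ of the exhaustion,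 the limit defining $p_t(x,y)$ exists for all $x,y\in V$ and $t\ge0$, and $$\sum_{y\in V}p_t(x,y)=1\qquad\text{for all } x\in V \text{ and all } t>0 .$$ -/

import Mathlib

namespace GraphHeat

open Filter Topology

/-- The Laplacian `Δ f (x) = ∑_{y ∼ x} (f x - f y)` of a locally finite graph. -/
def laplacian {V : Type*} (G : SimpleGraph V) [G.LocallyFinite] (f : V → ℝ) (x : V) : ℝ :=
  ∑ y ∈ G.neighborFinset x, (f x - f y)

/-- In a locally finite graph the vertices at distance at most `r` from `o` are finite in number. -/
theorem finite_edist_le {V : Type*} (G : SimpleGraph V) [G.LocallyFinite] (r : ℕ) :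
    ∀ o : V, {x : V | G.edist o x ≤ r}.Finite := by
  induction r with
  | zero =>
    intro o
    refine (Set.finite_singleton o).subset fun x hx => ?_
    have h0 : G.edist o x ≤ ((0 : ℕ) : ℕ∞) := hx
    exact (SimpleGraph.edist_eq_zero_iff.mp (nonpos_iff_eq_zero.mp h0)).symm
  | succ r ih =>
    intro o
    have hfin : ({o} ∪ ⋃ y ∈ G.neighborSet o, {x : V | G.edist y x ≤ r}).Finite :=
      (Set.finite_singleton o).union ((Set.toFinite (G.neighborSet o)).biUnion fun y _ => ih y)
    refine hfin.subset fun x hx => ?_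
    have hx' : G.edist o x ≤ ((r + 1 : ℕ) : ℕ∞) := hx
    have hne : G.edist o x ≠ ⊤ := ne_top_of_le_ne_top (ENat.natCast_ne_top _) hx'
    obtain ⟨p, hp⟩ := SimpleGraph.exists_walk_of_edist_ne_top hne
    rw [← hp] at hx'
    cases p with
    | nil => exact Or.inl rfl
    | cons hadj q =>
      refine Or.inr (Set.mem_biUnion hadj ?_)
      have hq : q.length ≤ r := by
        have := Nat.cast_le.mp hx'
        simpa using this
      exact (SimpleGraph.edist_le q).trans (Nat.cast_le.mpr hq)

/-- The ball `B_r(o)`: the vertices at distance at most `r` from `o`. -/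
noncomputable def closedBall {V : Type*} (G : SimpleGraph V) [G.LocallyFinite]
    (o : V) (r : ℕ) : Finset V :=
  (finite_edist_le G r o).toFinset

open Classical in
/-- The sphere `S_r(o)`: the vertices at distance exactly `r` from `o`. -/
noncomputable def sphere {V : Type*} (G : SimpleGraph V) [G.LocallyFinite]
    (o : V) (r : ℕ) : Finset V :=
  (closedBall G o r).filter fun x => G.edist o x = r

/-- `M_o(r)`, the maximal valence of a vertex of the sphere `S_r(o)`
(by convention `0` if the sphere is empty, which cannot happen in an infinite, locally finite,
connected graph). -/
noncomputable def maxValence {V : Type*} (G : SimpleGraph V) [G.LocallyFinite]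
    (o : V) (r : ℕ) : ℕ :=
  (sphere G o r).sup fun x => G.degree x

open Classical in
/-- `int D`: the vertices of `D` all of whose neighbours are in `D`. -/
noncomputable def interior {V : Type*} (G : SimpleGraph V) (D : Finset V) : Finset V :=
  D.filter fun x => ∀ y, G.Adj x y → y ∈ D

open Classical in
/-- The reduced (Dirichlet) Laplacian of `D`: the functions on `D` that vanish on the boundary
`D \ int D` are the functions on `int D`, extended by zero; on this space the operator is
`f ↦ (Δ f)|_{int D}`. This is its matrix in the basis of delta functions: the `(x, y)` entry is
`Δ δ_y (x)`. -/
noncomputable def reducedLaplacian {V : Type*} (G : SimpleGraph V) [G.LocallyFinite]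
    (D : Finset V) : Matrix (interior G D) (interior G D) ℝ :=
  Matrix.of fun x y => laplacian G (Pi.single (y : V) (1 : ℝ)) (x : V)

open Classical in
/-- The Dirichlet heat kernel `p^D_t(x, y) = (e^{-t Δ_D} δ_x)(y)`, where `Δ_D` is the reduced
Laplacian, extended by zero to vertices outside `int D`. -/
noncomputable def dirichletHeatKernel {V : Type*} (G : SimpleGraph V) [G.LocallyFinite]
    (D : Finset V) (t : ℝ) (x y : V) : ℝ :=
  if h : x ∈ interior G D ∧ y ∈ interior G D then
    (Matrix.mulVec (NormedSpace.exp (-t • reducedLaplacian G D))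
      (Pi.single (⟨x, h.1⟩ : interior G D) (1 : ℝ))) ⟨y, h.2⟩
  else 0

/-- The heat kernel `p_t(x, y) = lim_{r → ∞} p^{B_r(o)}_t(x, y)`, constructed with the exhaustion
of the graph by the balls about `o`. -/
noncomputable def heatKernel {V : Type*} (G : SimpleGraph V) [G.LocallyFinite]
    (o : V) (t : ℝ) (x y : V) : ℝ :=
  limUnder atTop fun r : ℕ => dirichletHeatKernel G (closedBall G o r) t x y

/-- Stochastic completeness: `∑_y p_t(x, y) = 1` for every vertex `x` and every `t > 0`,
whichever vertex `o` is used as the centre of the exhaustion in the construction of `p`. -/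
def StochasticallyComplete {V : Type*} (G : SimpleGraph V) [G.LocallyFinite] : Prop :=
  ∀ (o x : V) (t : ℝ), 0 < t → HasSum (fun y => heatKernel G o t x y) 1

end GraphHeat

/-! The missing mass `1 - ∑_y p^D_t(x, y)` is the heat lost through the boundary of `D`, and a
barrier function bounds it. The barrier is `v(y) = 1 + ∑_{k < d(x₀, y)} 1 / M(k)`. A vertex at
distance `r` has at most `M(r)` neighbours, each raising `v` by at most `1 / M(r)`, so `-Δ v ≤ 1 ≤
v`, and divergence of the series makes `v` tend to infinity. Hence `e^t v` is a supersolution of the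
heat equation, and comparison bounds the loss from a ball by `e^t v(x) / m`, where `m` is a lower
bound of `v` off its interior (`mul_one_sub_heatContent_le`). As the balls grow, `m → ∞` and the
loss vanishes. All comparisons rest on the maximum principle `nonneg_of_heat_supersolution`, which
reduces to positivity of the exponential of a matrix with nonnegative off-diagonal entries. It also
gives the monotonicity in `D` and the bound by one that make the limit kernel exist. -/

namespace GraphHeat

open Filter Topology

/-! ### Positivity of matrix exponentials and comparison for linear systems. -/

section MatrixExp

variable {n : Type*} [Fintype n] [DecidableEq n]

/-- The exponential of an entrywise nonnegative matrix is entrywise nonnegative. -/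
theorem exp_apply_nonneg_of_nonneg {A : Matrix n n ℝ} (hA : ∀ i j, 0 ≤ A i j) (i j : n) :
    0 ≤ NormedSpace.exp A i j := by
  let _ : NormedRing (Matrix n n ℝ) := Matrix.linftyOpNormedRing
  let _ : NormedAlgebra ℝ (Matrix n n ℝ) := Matrix.linftyOpNormedAlgebra
  have hpow : ∀ k : ℕ, ∀ i j, 0 ≤ (A ^ k) i j := by
    intro k
    induction k with
    | zero => intro i j; rw [pow_zero, Matrix.one_apply]; split_ifs <;> norm_num
    | succ k ih =>
      intro i j
      rw [pow_succ, Matrix.mul_apply]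
      exact Finset.sum_nonneg fun l _ => mul_nonneg (ih i l) (hA l j)
  have hs := NormedSpace.exp_series_hasSum_exp' (𝕂 := ℝ) A
  have hij := (Pi.hasSum.mp (Pi.hasSum.mp hs i)) j
  refine hij.nonneg fun k => ?_
  exact mul_nonneg (by positivity) (hpow k i j)

/-- The exponential of a matrix with nonnegative off-diagonal entries is entrywise nonnegative. -/
theorem exp_apply_nonneg {A : Matrix n n ℝ} (hA : ∀ i j, i ≠ j → 0 ≤ A i j) (i j : n) :
    0 ≤ NormedSpace.exp A i j := by
  let _ : NormedRing (Matrix n n ℝ) := Matrix.linftyOpNormedRing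
  let _ : NormedAlgebra ℝ (Matrix n n ℝ) := Matrix.linftyOpNormedAlgebra
  -- Adding `c` times the identity makes the diagonal nonnegative and changes the exponential only
  -- by the positive factor `e^c`.
  set c : ℝ := ∑ k, |A k k| with hc
  have hdiag : ∀ k, -A k k ≤ c := fun k =>
    (neg_le_abs _).trans (Finset.single_le_sum (f := fun k => |A k k|)
      (fun _ _ => abs_nonneg _) (Finset.mem_univ k))
  have hB : ∀ i j, 0 ≤ (A + algebraMap ℝ (Matrix n n ℝ) c) i j := by
    intro i j
    rw [Matrix.add_apply, Matrix.algebraMap_matrix_apply]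
    split_ifs with h
    · subst h
      have := hdiag i
      simp only [Algebra.algebraMap_self, RingHom.id_apply]
      linarith
    · simpa using hA i j h
  have hsplit : NormedSpace.exp A =
      Real.exp (-c) • NormedSpace.exp (A + algebraMap ℝ (Matrix n n ℝ) c) := by
    have h1 : A = (A + algebraMap ℝ (Matrix n n ℝ) c) + algebraMap ℝ (Matrix n n ℝ) (-c) := by
      rw [map_neg]; abel
    conv_lhs => rw [h1]
    have hcomm : Commute (A + algebraMap ℝ (Matrix n n ℝ) c) (algebraMap ℝ _ (-c)) :=
      (Algebra.commutes (-c) _).symm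
    have hscalar : NormedSpace.exp (algebraMap ℝ (Matrix n n ℝ) (-c)) =
        algebraMap ℝ (Matrix n n ℝ) (Real.exp (-c)) := by
      rw [Real.exp_eq_exp_ℝ]
      exact (NormedSpace.algebraMap_exp_comm (𝔸 := Matrix n n ℝ) (-c)).symm
    rw [Matrix.exp_add_of_commute _ _ hcomm, hscalar, ← Algebra.commutes, ← Algebra.smul_def]
  rw [hsplit, Matrix.smul_apply]
  exact mul_nonneg (Real.exp_pos _).le (exp_apply_nonneg_of_nonneg hB i j)

theorem hasDerivAt_exp_smul_apply (A : Matrix n n ℝ) (s : ℝ) (i j : n) :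
    HasDerivAt (fun s : ℝ => NormedSpace.exp (s • A) i j) ((NormedSpace.exp (s • A) * A) i j) s := by
  let _ : NormedRing (Matrix n n ℝ) := Matrix.linftyOpNormedRing
  let _ : NormedAlgebra ℝ (Matrix n n ℝ) := Matrix.linftyOpNormedAlgebra
  have h := hasDerivAt_exp_smul_const (𝕂 := ℝ) A s
  exact hasDerivAt_pi.mp (hasDerivAt_pi.mp h i) j

/-- Comparison principle: if `A` has nonnegative off-diagonal entries, a supersolution of
`f' = A f` that starts nonnegative stays nonnegative. -/
theorem nonneg_of_mulVec_le_deriv {A : Matrix n n ℝ} (hA : ∀ i j, i ≠ j → 0 ≤ A i j)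
    {f f' : ℝ → n → ℝ} (hf : ∀ s i, HasDerivAt (fun s => f s i) (f' s i) s)
    (hle : ∀ s, 0 ≤ s → ∀ i, A.mulVec (f s) i ≤ f' s i) (h0 : ∀ i, 0 ≤ f 0 i)
    {T : ℝ} (hT : 0 ≤ T) (i : n) : 0 ≤ f T i := by
  -- Duhamel: `E s * f s` runs from `e^{TA} f(0) ≥ 0` at `s = 0` to `f(T)` at `s = T`, with
  -- derivative `E s * (f' - A f) ≥ 0`.
  set E : ℝ → Matrix n n ℝ := fun s => NormedSpace.exp ((T - s) • A) with hE
  have hEpos : ∀ s, s ≤ T → ∀ i j, 0 ≤ E s i j := fun s hs =>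
    exp_apply_nonneg fun i j hij => mul_nonneg (sub_nonneg.mpr hs) (hA i j hij)
  have hEd : ∀ s i j, HasDerivAt (fun s => E s i j) (-(E s * A) i j) s := by
    intro s i j
    have h := (hasDerivAt_exp_smul_apply A (T - s) i j).comp s
      ((hasDerivAt_id s).const_sub T)
    simpa [hE, Function.comp_def] using h
  have hg : ∀ s, HasDerivAt (fun s => (E s).mulVec (f s) i)
      ((E s).mulVec (fun j => f' s j - A.mulVec (f s) j) i) s := by
    intro s
    have h := HasDerivAt.fun_sum (u := Finset.univ) fun j _ => (hEd s i j).mul (hf s j)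
    refine h.congr_deriv ?_
    have h2 : (E s).mulVec (fun j => f' s j - A.mulVec (f s) j) i
        = (E s).mulVec (f' s) i - (E s * A).mulVec (f s) i := by
      rw [← Matrix.mulVec_mulVec, ← Pi.sub_apply, ← Matrix.mulVec_sub]; rfl
    rw [h2, Matrix.mulVec, Matrix.mulVec, dotProduct, dotProduct, ← Finset.sum_sub_distrib]
    exact Finset.sum_congr rfl fun j _ => by ring
  have hmono : MonotoneOn (fun s => (E s).mulVec (f s) i) (Set.Icc 0 T) := by
    refine monotoneOn_of_deriv_nonneg (convex_Icc 0 T)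
      (fun s _ => (hg s).continuousAt.continuousWithinAt)
      (fun s _ => (hg s).differentiableAt.differentiableWithinAt) fun s hs => ?_
    rw [interior_Icc] at hs
    rw [(hg s).deriv]
    exact Finset.sum_nonneg fun j _ => mul_nonneg (hEpos s hs.2.le i j)
      (sub_nonneg.mpr (hle s hs.1.le j))
  have h := hmono (Set.left_mem_Icc.mpr hT) (Set.right_mem_Icc.mpr hT) hT
  have hT' : (E T).mulVec (f T) i = f T i := by
    simp [hE]
  have h0' : 0 ≤ (E 0).mulVec (f 0) i :=
    Finset.sum_nonneg fun j _ => mul_nonneg (hEpos 0 hT i j) (h0 j)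
  simp only [hT'] at h
  exact h0'.trans h

end MatrixExp

/-! ### The Laplacian and the parabolic maximum principle. -/

section Laplacian

variable {V : Type*} (G : SimpleGraph V) [G.LocallyFinite]

theorem laplacian_sub (f g : V → ℝ) (x : V) :
    laplacian G (fun y => f y - g y) x = laplacian G f x - laplacian G g x := by
  simp only [laplacian, ← Finset.sum_sub_distrib]
  exact Finset.sum_congr rfl fun y _ => by ring

theorem laplacian_const_mul (c : ℝ) (f : V → ℝ) (x : V) :
    laplacian G (fun y => c * f y) x = c * laplacian G f x := by
  simp only [laplacian, Finset.mul_sum, mul_sub]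

theorem laplacian_const (c : ℝ) (x : V) : laplacian G (fun _ => c) x = 0 := by
  simp [laplacian]

theorem laplacian_sum {ι : Type*} (s : Finset ι) (f : ι → V → ℝ) (x : V) :
    laplacian G (fun y => ∑ i ∈ s, f i y) x = ∑ i ∈ s, laplacian G (f i) x := by
  simp only [laplacian, ← Finset.sum_sub_distrib]
  exact Finset.sum_comm

open Classical in
theorem laplacian_single (x y : V) :
    laplacian G (Pi.single y (1 : ℝ)) x =
      (if x = y then (G.degree x : ℝ) else 0) - if G.Adj x y then 1 else 0 := by
  simp [laplacian, Pi.single_apply, Finset.sum_sub_distrib, Finset.sum_ite_eq']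

variable {G}

open Classical in
theorem reducedLaplacian_apply (D : Finset V) (x y : interior G D) :
    reducedLaplacian G D x y =
      (if x = y then (G.degree (x : V) : ℝ) else 0) - if G.Adj (x : V) y then 1 else 0 := by
  rw [reducedLaplacian, Matrix.of_apply]
  convert laplacian_single G (x : V) (y : V) using 3
  rw [Subtype.ext_iff]

theorem reducedLaplacian_transpose (D : Finset V) :
    (reducedLaplacian G D).transpose = reducedLaplacian G D := by
  ext x y
  rw [Matrix.transpose_apply, reducedLaplacian_apply, reducedLaplacian_apply, G.adj_comm]
  by_cases h : x = y
  · subst h; rfl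
  · rw [if_neg h, if_neg (Ne.symm h)]

open Classical in
/-- The reduced Laplacian acts as the Laplacian on functions extended by zero. -/
theorem reducedLaplacian_mulVec (D : Finset V) (f : V → ℝ) (x : interior G D) :
    (reducedLaplacian G D).mulVec (fun y => f y) x =
      laplacian G (fun y => if y ∈ interior G D then f y else 0) x := by
  have hf : (fun y => if y ∈ interior G D then f y else 0) =
      fun z => ∑ y ∈ interior G D, f y * (Pi.single y (1 : ℝ) : V → ℝ) z := by
    funext z
    simp [Pi.single_apply]
  rw [hf, laplacian_sum]
  simp only [laplacian_const_mul]
  rw [← Finset.sum_coe_sort (interior G D)]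
  refine Finset.sum_congr rfl fun y _ => ?_
  rw [mul_comm]
  rfl

/-- Maximum principle for the heat equation on the interior of a finite set: a supersolution which
is nonnegative initially and outside the interior is nonnegative. -/
theorem nonneg_of_heat_supersolution (D : Finset V) {u u' : ℝ → V → ℝ}
    (hu : ∀ s, ∀ y ∈ interior G D, HasDerivAt (fun s => u s y) (u' s y) s)
    (hle : ∀ s, 0 ≤ s → ∀ y ∈ interior G D, -laplacian G (u s) y ≤ u' s y)
    (hout : ∀ s, 0 ≤ s → ∀ y, y ∉ interior G D → 0 ≤ u s y)
    (h0 : ∀ y ∈ interior G D, 0 ≤ u 0 y) {T : ℝ} (hT : 0 ≤ T) (y : V) : 0 ≤ u T y := by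
  classical
  by_cases hy : y ∈ interior G D
  swap
  · exact hout T hT y hy
  refine nonneg_of_mulVec_le_deriv (A := -reducedLaplacian G D)
    (f := fun s (z : interior G D) => u s z) (f' := fun s z => u' s z)
    (fun i j hij => ?_) (fun s i => hu s i i.2) (fun s hs i => ?_) (fun i => h0 i i.2) hT
    (⟨y, hy⟩ : interior G D)
  · rw [Matrix.neg_apply, reducedLaplacian_apply, if_neg hij]
    split_ifs <;> norm_num
  · rw [Matrix.neg_mulVec, Pi.neg_apply, reducedLaplacian_mulVec D (u s) i]
    -- Since `u ≥ 0` off the interior, truncating it there to zero can only increase the Laplacian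
    -- at interior vertices.
    refine le_trans (neg_le_neg (Finset.sum_le_sum fun z _ => ?_)) (hle s hs i i.2)
    simp only [if_pos i.2]
    split_ifs with hz
    · exact le_rfl
    · have := hout s hs z hz
      linarith

end Laplacian

theorem interior_mono {V : Type*} {G : SimpleGraph V} {D D' : Finset V} (h : D ⊆ D') : interior G D ⊆ interior G D' := by
  classical
  intro x hx
  rw [interior, Finset.mem_filter] at hx ⊢
  exact ⟨h hx.1, fun y hy => h (hx.2 y hy)⟩

/-! ### Dirichlet heat kernels and heat content of finite sets. -/

section DirichletHeatKernel

variable {V : Type*} {G : SimpleGraph V} [G.LocallyFinite]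

theorem dirichletHeatKernel_of_notMem_left {D : Finset V} {x : V} (hx : x ∉ interior G D)
    (t : ℝ) (y : V) : dirichletHeatKernel G D t x y = 0 :=
  dif_neg fun h => hx h.1

theorem dirichletHeatKernel_of_notMem_right {D : Finset V} {y : V} (hy : y ∉ interior G D)
    (t : ℝ) (x : V) : dirichletHeatKernel G D t x y = 0 :=
  dif_neg fun h => hy h.2

open Classical in
theorem dirichletHeatKernel_eq {D : Finset V} (t : ℝ) (x y : interior G D) :
    dirichletHeatKernel G D t x y = NormedSpace.exp (t • -reducedLaplacian G D) y x := by
  rw [dirichletHeatKernel, dif_pos ⟨x.2, y.2⟩, smul_neg, ← neg_smul]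
  simp

theorem dirichletHeatKernel_comm (D : Finset V) (t : ℝ) (x y : V) :
    dirichletHeatKernel G D t x y = dirichletHeatKernel G D t y x := by
  classical
  by_cases hx : x ∈ interior G D
  swap
  · rw [dirichletHeatKernel_of_notMem_left hx, dirichletHeatKernel_of_notMem_right hx]
  by_cases hy : y ∈ interior G D
  swap
  · rw [dirichletHeatKernel_of_notMem_left hy, dirichletHeatKernel_of_notMem_right hy]
  lift x to interior G D using hx
  lift y to interior G D using hy
  rw [dirichletHeatKernel_eq, dirichletHeatKernel_eq, ← Matrix.transpose_apply (NormedSpace.exp _),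
    ← Matrix.exp_transpose, Matrix.transpose_smul, Matrix.transpose_neg,
    reducedLaplacian_transpose]

open Classical in
theorem dirichletHeatKernel_zero (D : Finset V) (x y : V) :
    dirichletHeatKernel G D 0 x y = if x ∈ interior G D ∧ y = x then 1 else 0 := by
  by_cases hx : x ∈ interior G D
  swap
  · rw [dirichletHeatKernel_of_notMem_left hx, if_neg fun h => hx h.1]
  by_cases hy : y ∈ interior G D
  swap
  · rw [dirichletHeatKernel_of_notMem_right hy, if_neg]
    rintro ⟨-, rfl⟩
    exact hy hx
  lift x to interior G D using hx
  lift y to interior G D using hy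
  rw [dirichletHeatKernel_eq, zero_smul, NormedSpace.exp_zero, Matrix.one_apply]
  by_cases h : y = x
  · rw [if_pos h, if_pos ⟨x.2, congrArg _ h⟩]
  · rw [if_neg h, if_neg fun h' => h (Subtype.ext h'.2)]

/-- The Dirichlet heat kernel solves the heat equation in its second variable. -/
theorem hasDerivAt_dirichletHeatKernel (D : Finset V) (x : V) (s : ℝ) {y : V}
    (hy : y ∈ interior G D) :
    HasDerivAt (fun s => dirichletHeatKernel G D s x y)
      (-laplacian G (dirichletHeatKernel G D s x) y) s := by
  classical
  by_cases hx : x ∈ interior G D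
  swap
  · have h0 : ∀ s, dirichletHeatKernel G D s x = fun _ => 0 := fun s =>
      funext fun z => dirichletHeatKernel_of_notMem_left hx s z
    simp only [h0, laplacian_const, neg_zero]
    exact hasDerivAt_const s 0
  have hext : dirichletHeatKernel G D s x =
      fun z => if z ∈ interior G D then dirichletHeatKernel G D s x z else 0 := by
    funext z
    split_ifs with hz
    · rfl
    · exact dirichletHeatKernel_of_notMem_right hz s x
  lift x to interior G D using hx
  lift y to interior G D using hy
  have hd := hasDerivAt_exp_smul_apply (-reducedLaplacian G D) s y x
  rw [hext, ← reducedLaplacian_mulVec]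
  simp only [dirichletHeatKernel_eq]
  refine hd.congr_deriv ?_
  have hcomm : Commute (NormedSpace.exp (s • -reducedLaplacian G D)) (-reducedLaplacian G D) := by
    let _ : NormedRing (Matrix (interior G D) (interior G D) ℝ) := Matrix.linftyOpNormedRing
    let _ : NormedAlgebra ℝ (Matrix (interior G D) (interior G D) ℝ) :=
      Matrix.linftyOpNormedAlgebra
    exact ((Commute.refl (-reducedLaplacian G D)).smul_left s).exp_left
  rw [hcomm.eq, neg_mul, Matrix.neg_apply]
  rfl

theorem dirichletHeatKernel_nonneg (D : Finset V) {t : ℝ} (ht : 0 ≤ t) (x y : V) :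
    0 ≤ dirichletHeatKernel G D t x y := by
  classical
  refine nonneg_of_heat_supersolution (G := G) D (u := fun s => dirichletHeatKernel G D s x)
    (fun s y hy => hasDerivAt_dirichletHeatKernel D x s hy) (fun s _ y _ => le_rfl)
    (fun s _ y hy => (dirichletHeatKernel_of_notMem_right hy s x).ge) (fun y _ => ?_) ht y
  simp only [dirichletHeatKernel_zero]
  split_ifs <;> norm_num

/-- Domain monotonicity of the Dirichlet heat kernel. -/
theorem dirichletHeatKernel_mono {D D' : Finset V} (h : D ⊆ D') {t : ℝ} (ht : 0 ≤ t) (x y : V) :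
    dirichletHeatKernel G D t x y ≤ dirichletHeatKernel G D' t x y := by
  classical
  have hI := interior_mono (G := G) h
  -- The difference solves the heat equation on `int D`; off `int D` it is the kernel of `D'`, hence
  -- nonnegative.
  refine sub_nonneg.mp (nonneg_of_heat_supersolution (G := G) D
    (u := fun s y => dirichletHeatKernel G D' s x y - dirichletHeatKernel G D s x y)
    (fun s y hy => (hasDerivAt_dirichletHeatKernel D' x s (hI hy)).sub
      (hasDerivAt_dirichletHeatKernel D x s hy)) (fun s _ y _ => ?_) (fun s hs y hy => ?_)
    (fun y _ => ?_) ht y)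
  · rw [laplacian_sub]
    linarith
  · rw [dirichletHeatKernel_of_notMem_right hy, sub_zero]
    exact dirichletHeatKernel_nonneg D' hs x y
  · simp only [dirichletHeatKernel_zero]
    by_cases hx : x ∈ interior G D
    · simp [hx, hI hx]
    · simp only [hx, false_and, if_false, sub_zero]
      split_ifs <;> norm_num

/-- The total heat content `∑_y p^D_t(x, y)`. -/
noncomputable def heatContent (G : SimpleGraph V) [G.LocallyFinite] (D : Finset V) (t : ℝ)
    (x : V) : ℝ :=
  ∑ y ∈ interior G D, dirichletHeatKernel G D t x y

theorem heatContent_of_notMem {D : Finset V} {x : V} (hx : x ∉ interior G D) (t : ℝ) :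
    heatContent G D t x = 0 :=
  Finset.sum_eq_zero fun y _ => dirichletHeatKernel_of_notMem_left hx t y

theorem heatContent_zero {D : Finset V} {x : V} (hx : x ∈ interior G D) :
    heatContent G D 0 x = 1 := by
  classical
  simp [heatContent, dirichletHeatKernel_zero, hx]

/-- The kernel solves the heat equation in its second variable; symmetry transfers this to the
starting point `x`. -/
theorem hasDerivAt_heatContent (D : Finset V) (s : ℝ) {x : V} (hx : x ∈ interior G D) :
    HasDerivAt (fun s => heatContent G D s x) (-laplacian G (heatContent G D s) x) s := by
  have hsum : ∀ s, heatContent G D s =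
      fun x => ∑ y ∈ interior G D, dirichletHeatKernel G D s y x := fun s =>
    funext fun x => Finset.sum_congr rfl fun y _ => dirichletHeatKernel_comm D s x y
  simp only [hsum]
  rw [laplacian_sum, ← Finset.sum_neg_distrib]
  exact HasDerivAt.fun_sum fun y _ => hasDerivAt_dirichletHeatKernel D y s hx

theorem heatContent_le_one (D : Finset V) {t : ℝ} (ht : 0 ≤ t) (x : V) :
    heatContent G D t x ≤ 1 := by
  refine sub_nonneg.mp (nonneg_of_heat_supersolution (G := G) D
    (u := fun s x => 1 - heatContent G D s x)
    (fun s y hy => (hasDerivAt_heatContent D s hy).const_sub 1) (fun s _ y _ => ?_)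
    (fun s hs y hy => ?_) (fun y hy => ?_) ht x)
  · rw [laplacian_sub, laplacian_const, zero_sub]
  · simp [heatContent_of_notMem hy]
  · simp [heatContent_zero hy]

/-- Khas'minskii estimate: if `v ≥ 0` satisfies `-Δ v ≤ v` and `v ≥ m` outside `int D`, then the
heat lost from `D` up to time `t` is at most `e^t v / m`. -/
theorem mul_one_sub_heatContent_le (D : Finset V) {v : V → ℝ} {m : ℝ} (hv : ∀ x, 0 ≤ v x)
    (hΔ : ∀ x, -laplacian G v x ≤ v x) (hm : ∀ x, x ∉ interior G D → m ≤ v x)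
    {t : ℝ} (ht : 0 ≤ t) (x : V) :
    m * (1 - heatContent G D t x) ≤ Real.exp t * v x := by
  -- The factor `e^s` turns `-Δ v ≤ v` into the supersolution inequality for `e^s v`.
  refine sub_nonneg.mp (nonneg_of_heat_supersolution (G := G) D
    (u := fun s x => Real.exp s * v x - m * (1 - heatContent G D s x))
    (fun s y hy => ((Real.hasDerivAt_exp s).mul_const (v y)).sub
      (((hasDerivAt_heatContent D s hy).const_sub 1).const_mul m)) (fun s _ y _ => ?_)
    (fun s hs y hy => ?_) (fun y hy => ?_) ht x)
  · rw [laplacian_sub, laplacian_const_mul, laplacian_const_mul, laplacian_sub, laplacian_const]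
    have := mul_le_mul_of_nonneg_left (hΔ y) (Real.exp_pos s).le
    linarith
  · rw [heatContent_of_notMem hy, sub_zero, mul_one, sub_nonneg]
    exact (hm y hy).trans (le_mul_of_one_le_left (hv y) (Real.one_le_exp hs))
  · simpa [heatContent_zero hy] using hv y

end DirichletHeatKernel

theorem dist_le_dist_add_one {V : Type*} {G : SimpleGraph V} (hG : G.Connected) (o : V)
    {x y : V} (h : G.Adj x y) :
    G.dist o y ≤ G.dist o x + 1 := by
  have := hG.dist_triangle (u := o) (v := x) (w := y)
  rwa [SimpleGraph.dist_eq_one_iff_adj.mpr h] at this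

/-! ### Balls and the radial barrier function. -/

section Exhaustion

variable {V : Type*} {G : SimpleGraph V} [G.LocallyFinite]

theorem mem_closedBall (hG : G.Connected) {o x : V} {r : ℕ} :
    x ∈ closedBall G o r ↔ G.dist o x ≤ r := by
  rw [closedBall, Set.Finite.mem_toFinset, Set.mem_ofPred_eq, ← (hG o x).coe_dist_eq_edist,
    Nat.cast_le]

theorem mem_sphere (hG : G.Connected) {o x : V} {r : ℕ} :
    x ∈ sphere G o r ↔ G.dist o x = r := by
  classical
  rw [sphere, Finset.mem_filter, mem_closedBall hG, ← (hG o x).coe_dist_eq_edist, Nat.cast_inj]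
  exact ⟨fun h => h.2, fun h => ⟨h.le, h⟩⟩

theorem degree_le_maxValence (hG : G.Connected) (o x : V) :
    G.degree x ≤ maxValence G o (G.dist o x) :=
  Finset.le_sup (f := fun x => G.degree x) ((mem_sphere hG).mpr rfl)

theorem closedBall_mono (hG : G.Connected) (o : V) {r s : ℕ} (h : r ≤ s) :
    closedBall G o r ⊆ closedBall G o s := fun _ hx =>
  (mem_closedBall hG).mpr (((mem_closedBall hG).mp hx).trans h)

theorem le_dist_of_notMem_interior (hG : G.Connected) {o x : V} {r : ℕ}
    (hx : x ∉ interior G (closedBall G o r)) : r ≤ G.dist o x := by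
  classical
  by_contra! hlt
  refine hx ?_
  rw [interior, Finset.mem_filter]
  refine ⟨(mem_closedBall hG).mpr hlt.le, fun y hy => (mem_closedBall hG).mpr ?_⟩
  exact (dist_le_dist_add_one hG o hy).trans hlt

/-- The radial function `r ↦ 1 + ∑_{k < r} 1 / M(k)`. -/
noncomputable def radialWeight (G : SimpleGraph V) [G.LocallyFinite] (o : V) (r : ℕ) : ℝ :=
  1 + ∑ k ∈ Finset.range r, (1 : ℝ) / (maxValence G o k : ℝ)

theorem radialWeight_mono (o : V) : Monotone (radialWeight G o) :=
  monotone_nat_of_le_succ fun r => by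
    rw [radialWeight, radialWeight, Finset.sum_range_succ, ← add_assoc]
    exact le_add_of_nonneg_right (by positivity)

theorem one_le_radialWeight (o : V) (r : ℕ) : 1 ≤ radialWeight G o r :=
  le_add_of_nonneg_right (Finset.sum_nonneg fun _ _ => by positivity)

theorem neg_laplacian_radialWeight_le (hG : G.Connected) (o x : V) :
    -laplacian G (fun y => radialWeight G o (G.dist o y)) x ≤ 1 := by
  set r := G.dist o x with hr
  have hterm : ∀ y ∈ G.neighborFinset x,
      radialWeight G o (G.dist o y) - radialWeight G o r ≤ 1 / (maxValence G o r : ℝ) := by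
    intro y hy
    have h := radialWeight_mono (G := G) o
      (dist_le_dist_add_one hG o ((G.mem_neighborFinset x y).mp hy))
    rw [← hr] at h
    have h2 : radialWeight G o (r + 1) = radialWeight G o r + 1 / (maxValence G o r : ℝ) := by
      rw [radialWeight, radialWeight, Finset.sum_range_succ, add_assoc]
    linarith
  have hsum := Finset.sum_le_card_nsmul _ _ _ hterm
  rw [G.card_neighborFinset_eq_degree, nsmul_eq_mul, mul_one_div] at hsum
  have hdeg : (G.degree x : ℝ) / (maxValence G o r : ℝ) ≤ 1 :=
    -- This also covers `M(r) = 0`, where the quotient is `0` by convention.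
    div_le_one_of_le₀ (Nat.cast_le.mpr (degree_le_maxValence hG o x)) (Nat.cast_nonneg _)
  refine le_trans (le_of_eq ?_) (hsum.trans hdeg)
  rw [laplacian, ← Finset.sum_neg_distrib]
  exact Finset.sum_congr rfl fun y _ => by ring

/-! ### Passage to the limit along balls. -/

theorem sum_dirichletHeatKernel_le_heatContent (D : Finset V) {t : ℝ} (ht : 0 ≤ t) (x : V)
    (s : Finset V) : ∑ y ∈ s, dirichletHeatKernel G D t x y ≤ heatContent G D t x := by
  classical
  rw [heatContent, Finset.sum_subset (Finset.subset_union_left (s₁ := interior G D) (s₂ := s))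
    fun y _ hy => dirichletHeatKernel_of_notMem_right hy t x]
  exact Finset.sum_le_sum_of_subset_of_nonneg Finset.subset_union_right
    fun y _ _ => dirichletHeatKernel_nonneg D ht x y

theorem dirichletHeatKernel_le_one (D : Finset V) {t : ℝ} (ht : 0 ≤ t) (x y : V) :
    dirichletHeatKernel G D t x y ≤ 1 := by
  have h := sum_dirichletHeatKernel_le_heatContent (G := G) D ht x {y}
  rw [Finset.sum_singleton] at h
  exact h.trans (heatContent_le_one D ht x)

theorem monotone_dirichletHeatKernel_closedBall (hG : G.Connected) (o : V) {t : ℝ} (ht : 0 ≤ t)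
    (x y : V) : Monotone fun r : ℕ => dirichletHeatKernel G (closedBall G o r) t x y :=
  fun _ _ h => dirichletHeatKernel_mono (closedBall_mono hG o h) ht x y

theorem tendsto_heatKernel (hG : G.Connected) (o : V) {t : ℝ} (ht : 0 ≤ t) (x y : V) :
    Tendsto (fun r : ℕ => dirichletHeatKernel G (closedBall G o r) t x y) atTop
      (𝓝 (heatKernel G o t x y)) :=
  tendsto_nhds_limUnder ⟨_, tendsto_atTop_ciSup
    (monotone_dirichletHeatKernel_closedBall hG o ht x y)
    ⟨1, Set.forall_mem_range.mpr fun _ => dirichletHeatKernel_le_one _ ht x y⟩⟩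

theorem dirichletHeatKernel_le_heatKernel (hG : G.Connected) (o : V) {t : ℝ} (ht : 0 ≤ t)
    (x y : V) (r : ℕ) :
    dirichletHeatKernel G (closedBall G o r) t x y ≤ heatKernel G o t x y :=
  (monotone_dirichletHeatKernel_closedBall hG o ht x y).ge_of_tendsto
    (tendsto_heatKernel hG o ht x y) r

theorem heatKernel_nonneg (hG : G.Connected) (o : V) {t : ℝ} (ht : 0 ≤ t) (x y : V) :
    0 ≤ heatKernel G o t x y :=
  (dirichletHeatKernel_nonneg _ ht x y).trans (dirichletHeatKernel_le_heatKernel hG o ht x y 0)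

theorem sum_heatKernel_le_one (hG : G.Connected) (o : V) {t : ℝ} (ht : 0 ≤ t) (x : V)
    (s : Finset V) : ∑ y ∈ s, heatKernel G o t x y ≤ 1 :=
  le_of_tendsto' (tendsto_finsetSum s fun y _ => tendsto_heatKernel hG o ht x y) fun _ =>
    (sum_dirichletHeatKernel_le_heatContent _ ht x s).trans (heatContent_le_one _ ht x)

/-- If `∑ 1 / M(r) = ∞`, the heat contents of the balls tend to one. -/
theorem tendsto_heatContent_closedBall (hG : G.Connected) {x₀ : V}
    (hM : Tendsto (fun n : ℕ => ∑ r ∈ Finset.range n, (1 : ℝ) / (maxValence G x₀ r : ℝ))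
      atTop atTop) (o : V) {t : ℝ} (ht : 0 ≤ t) (x : V) :
    Tendsto (fun r : ℕ => heatContent G (closedBall G o r) t x) atTop (𝓝 1) := by
  set v : V → ℝ := fun y => radialWeight G x₀ (G.dist x₀ y) with hv
  -- A vertex off the interior of `B_r(o)` is at distance at least `r - d(o, x₀)` from `x₀`. The
  -- truncated subtraction gives `m r = 1` for small `r`, still a valid lower bound.
  set m : ℕ → ℝ := fun r => radialWeight G x₀ (r - G.dist o x₀) with hm
  have hm1 : ∀ r, 0 < m r := fun r => zero_lt_one.trans_le (one_le_radialWeight _ _)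
  have hmtop : Tendsto m atTop atTop :=
    (tendsto_atTop_add_const_left atTop 1 hM).comp (tendsto_sub_atTop_nat (G.dist o x₀))
  have hbound : ∀ r, 1 - Real.exp t * v x / m r ≤ heatContent G (closedBall G o r) t x := by
    intro r
    have h := mul_one_sub_heatContent_le (G := G) (closedBall G o r) (v := v) (m := m r)
      (fun y => zero_le_one.trans (one_le_radialWeight _ _))
      -- The summand `1` in the weight serves here: `-Δ v ≤ 1 ≤ v`.
      (fun y => (neg_laplacian_radialWeight_le hG x₀ y).trans (one_le_radialWeight _ _))
      (fun y hy => radialWeight_mono x₀ ?_) ht x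
    · rw [mul_comm, ← le_div_iff₀ (hm1 r)] at h
      linarith
    · have h1 := le_dist_of_notMem_interior hG hy
      have h2 := hG.dist_triangle (u := o) (v := x₀) (w := y)
      omega
  have hlim : Tendsto (fun r => 1 - Real.exp t * v x / m r) atTop (𝓝 1) := by
    simpa using (hmtop.const_div_atTop (Real.exp t * v x)).const_sub 1
  exact tendsto_of_tendsto_of_tendsto_of_le_of_le hlim tendsto_const_nhds hbound
    fun r => heatContent_le_one _ ht x

end Exhaustion

end GraphHeat

theorem mainTheorem1 {V : Type*} [Infinite V] (G : SimpleGraph V) [G.LocallyFinite]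
    (hG : G.Connected) (x₀ : V)
    (hM : Filter.Tendsto
      (fun n : ℕ => ∑ r ∈ Finset.range n, (1 : ℝ) / (GraphHeat.maxValence G x₀ r : ℝ))
      Filter.atTop Filter.atTop) :
    (∀ (o : V) (t : ℝ), 0 ≤ t → ∀ x y : V,
      Filter.Tendsto
        (fun r : ℕ => GraphHeat.dirichletHeatKernel G (GraphHeat.closedBall G o r) t x y)
        Filter.atTop (nhds (GraphHeat.heatKernel G o t x y))) ∧
    GraphHeat.StochasticallyComplete G := by
  refine ⟨fun o t ht x y => GraphHeat.tendsto_heatKernel hG o ht x y, fun o x t ht => ?_⟩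
  have hle := GraphHeat.sum_heatKernel_le_one hG o ht.le x
  have hsum : Summable fun y => GraphHeat.heatKernel G o t x y :=
    summable_of_sum_le (GraphHeat.heatKernel_nonneg hG o ht.le x) hle
  refine hsum.hasSum_iff.mpr (le_antisymm (hsum.tsum_le_of_sum_le hle) ?_)
  -- Each heat content is a finite sum of Dirichlet kernels, hence at most the full sum of `p_t(x,
  -- y)`; these contents tend to one.
  refine le_of_tendsto' (GraphHeat.tendsto_heatContent_closedBall hG hM o ht.le x) fun r => ?_
  exact (Finset.sum_le_sum fun y _ =>
    GraphHeat.dirichletHeatKernel_le_heatKernel hG o ht.le x y r).trans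
    (hsum.sum_le_tsum _ fun y _ => GraphHeat.heatKernel_nonneg hG o ht.le x y)
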